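/- A permutation of length $n$ is an ordering $\pi=\pi_1\pi_2\cdots\pi_n$ of the integers $1,\dots,n$. The set of all permutations (of all lengths) is partially ordered by pattern containment: $\sigma\le\pi$ if $\pi$ has a subsequence whose letters are in the same relative order as those of $\sigma$. Let $\mu(\pi)=\mu(\mathbf 1,\pi)$, where $\mu$ is the Möbius function of this poset and $\mathbf 1$ is the permutation of length $1$. A descent of $\pi$ occurs at position $i$ if $\pi_i>\pi_{i+1}$. An adjacency of length $\ell$ at position $i$ is a sequence of consecutive letters $\pi_i\pi_{i+1}\cdots\pi_{i+\ell-1}$ with $\pi_{i+j}=\pi_i+j$ for $0\le j<\ell$; an adjacency pair is an adjacency of length $2$, a triple adjacency is one of length $3$ (so a triple adjacency contains two adjacency pairs), and "no adjacencies" means none of length at least $2$. The position and the value of an adjacency pair are those of its first letter, and pairs are ordered by position. Let $M_n=246\cdots135\cdots$ and $W_n=135\cdots246\cdots$ be the permutations of length $n$ that list the even letters and then the odd ones, respectively the odd letters and then the even ones, each in increasing order. **Theorem 3.6.** Let $\pi$ be a permutation of length $n>2$ with exactly one descent. Then the value of $\mu(\pi)$ can be computed from the number and positions of adjacencies in $\pi$,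 as follows. 1. If $\mu(\pi)\neq 0$, then $\mu(\pi)$ is positive if and only if $n$ is odd. 2. If $\pi$ begins with $12$ or ends in $(n-1)n$, then $\mu(\pi)=0$. 3. If $\pi$ has a triple adjacency, then $\mu(\pi)=0$. 4. If $\pi$ has more than two adjacency pairs, then $\mu(\pi)=0$. 5. If $\pi$ has exactly two adjacency pairs, then: (a) if the first adjacency pair has greater value than the second, then $|\mu(\pi)|=1$; (b) if the first adjacency pair has lower value than the second, then $\mu(\pi)=0$. 6. If $\pi$ has exactly one adjacency pair, at position $i$, and the descent is at position $d$, then: (a) if $i<d$ and $\pi_1\neq1$, then $|\mu(\pi)|=i$; (b) if $i<d$ and $\pi_1=1$, then $|\mu(\pi)|=i-1$; (c) if $i>d$ and $\pi_n\neq n$, then $|\mu(\pi)|=n-i$; (d) if $i>d$ and $\pi_n=n$, then $|\mu(\pi)|=n-i-1$. 7. If $\pi$ has no adjacencies, then $\pi=W_n$ or $\pi=M_n$, and: (a) if $n$ is even and $\pi_1=1$, then $\pi=W_n$ and $\mu(\pi)=-\binom{n/2}{2}$; (b) if $n$ is even and $\pi_1=2$, then $\pi=M_n$ and $\mu(\pi)=-\binom{n/2+1}{2}$;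 (c) if $n$ is odd, then $\mu(\pi)=\binom{(n+1)/2}{2}$. -/

import Mathlib

/-- A permutation of some finite length `n`, as an element of the set of all permutations.
The permutation of `Fin n` sends the (zero-based) position of a letter to its (zero-based) value. -/
structure FinPerm where
  /-- The number of letters. -/
  length : ℕ
  /-- The permutation itself. -/
  perm : Equiv.Perm (Fin length)

namespace FinPerm

/-- `σ ≤ π` if `σ` occurs as a pattern in `π`, that is, if some subsequence of `π` (chosen by a
strictly increasing map `f` of positions) has the same relative order of letters as `σ`. -/
instance : LE FinPerm where
  le σ π := ∃ f : Fin σ.length → Fin π.length, StrictMono f ∧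
    ∀ i j, σ.perm i < σ.perm j ↔ π.perm (f i) < π.perm (f j)

theorem le_def (σ π : FinPerm) : σ ≤ π ↔
    ∃ f : Fin σ.length → Fin π.length, StrictMono f ∧
      ∀ i j, σ.perm i < σ.perm j ↔ π.perm (f i) < π.perm (f j) := Iff.rfl

theorem length_le {σ π : FinPerm} (h : σ ≤ π) : σ.length ≤ π.length := by
  obtain ⟨f, hf, -⟩ := h
  simpa using Fintype.card_le_of_injective f hf.injective

/-- Pattern containment is a partial order. -/
instance : PartialOrder FinPerm where
  le_refl σ := ⟨id, strictMono_id, fun _ _ => Iff.rfl⟩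
  le_trans := by
    rintro σ τ π ⟨f, hf, hf'⟩ ⟨g, hg, hg'⟩
    exact ⟨g ∘ f, hg.comp hf, fun i j => (hf' i j).trans (hg' (f i) (f j))⟩
  le_antisymm := by
    intro σ π h1 h2
    have hl := le_antisymm (length_le h1) (length_le h2)
    obtain ⟨n, s⟩ := σ
    obtain ⟨m, p⟩ := π
    obtain rfl : n = m := hl
    obtain ⟨f, hf, hf'⟩ := h1
    change Fin n → Fin n at f
    have hfs : Function.Surjective f := Finite.surjective_of_injective hf.injective
    have hid : f = id := by
      have e : StrictMono.orderIsoOfSurjective f hf hfs = OrderIso.refl _ := Subsingleton.elim _ _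
      funext i
      exact congrArg (fun g : Fin n ≃o Fin n => g i) e
    subst hid
    have hmono : StrictMono (fun i => p (s.symm i)) := by
      intro a b hab
      have := (hf' (s.symm a) (s.symm b)).1 (by simpa using hab)
      simpa using this
    have hsurj : Function.Surjective (fun i => p (s.symm i)) :=
      p.surjective.comp s.symm.surjective
    have e : StrictMono.orderIsoOfSurjective _ hmono hsurj = OrderIso.refl _ :=
      Subsingleton.elim _ _
    have hsp : s = p := by
      ext i
      have := congrArg (fun g : Fin n ≃o Fin n => g (s i)) e
      simp at this
      rw [this]
    rw [hsp]

/-- There are finitely many permutations of length at most `n`. -/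
theorem finite_length_le (n : ℕ) : {σ : FinPerm | σ.length ≤ n}.Finite := by
  have : {σ : FinPerm | σ.length ≤ n} ⊆
      ⋃ m ∈ Set.Iic n, Set.range (fun p : Equiv.Perm (Fin m) => FinPerm.mk m p) := by
    rintro ⟨m, p⟩ h
    simp only [Set.mem_iUnion]
    exact ⟨m, h, p, rfl⟩
  exact ((Set.finite_Iic n).biUnion fun m _ => Set.finite_range _).subset this

/-- Intervals of permutations are finite. -/
noncomputable instance : LocallyFiniteOrder FinPerm :=
  LocallyFiniteOrder.ofFiniteIcc fun _ b =>
    (finite_length_le b.length).subset fun _ h => length_le h.2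

noncomputable instance : DecidableEq FinPerm := Classical.decEq _

/-- The permutation `1` of length one. -/
def one : FinPerm := ⟨1, Equiv.refl _⟩

end FinPerm

/-- The value `μ(1, π)` of the Möbius function of the poset of all permutations. -/
noncomputable def permMu {n : ℕ} (π : Equiv.Perm (Fin n)) : ℤ :=
  IncidenceAlgebra.mu ℤ FinPerm.one ⟨n, π⟩

/-- The letter `π_i ∈ {1, …, n}` at position `i ∈ {1, …, n}` in the one-line notation of `π`
(and `0` if there is no position `i`). -/
def letter {n : ℕ} (π : Equiv.Perm (Fin n)) (i : ℕ) : ℕ :=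
  if h : 1 ≤ i ∧ i ≤ n then (π ⟨i - 1, by omega⟩ : ℕ) + 1 else 0

/-- The set of the positions `i ∈ {1, …, n - 1}` at which a descent `π_i > π_{i+1}` occurs. -/
def descents {n : ℕ} (π : Equiv.Perm (Fin n)) : Finset ℕ :=
  {i ∈ Finset.Ico 1 n | letter π (i + 1) < letter π i}

/-- The `l` letters of `π` at the positions `i, …, i + l - 1` form an adjacency: they are
`π_i, π_i + 1, …, π_i + l - 1`, in this order. -/
def IsAdjacency {n : ℕ} (π : Equiv.Perm (Fin n)) (i l : ℕ) : Prop :=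
  1 ≤ i ∧ i + l ≤ n + 1 ∧ ∀ j < l, letter π (i + j) = letter π i + j

instance {n : ℕ} (π : Equiv.Perm (Fin n)) (i l : ℕ) : Decidable (IsAdjacency π i l) :=
  inferInstanceAs (Decidable (_ ∧ _ ∧ _))

/-- The set of the positions of the adjacency pairs (adjacencies of two letters) of `π`; the
position of a pair is that of its first letter. -/
def adjacencyPairs {n : ℕ} (π : Equiv.Perm (Fin n)) : Finset ℕ :=
  {i ∈ Finset.Icc 1 n | IsAdjacency π i 2}

/-- `π` is the permutation `M_n = 246…135…`. -/
def IsM {n : ℕ} (π : Equiv.Perm (Fin n)) : Prop :=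
  ∀ i ∈ Finset.Icc 1 n, letter π i = if i ≤ n / 2 then 2 * i else 2 * (i - n / 2) - 1

/-- `π` is the permutation `W_n = 135…246…`. -/
def IsW {n : ℕ} (π : Equiv.Perm (Fin n)) : Prop :=
  ∀ i ∈ Finset.Icc 1 n,
    letter π i = if i ≤ (n + 1) / 2 then 2 * i - 1 else 2 * (i - (n + 1) / 2)

/-! A permutation with at most one descent is coded by a binary word indexed by values: a value
carries `false` if it stands in the first increasing run and `true` if it stands in the second. The
permutation is the stable sort of its word (`ofWord`), and the patterns it contains are the stable
sorts of the subwords (`ofWord_mono`, `exists_word_of_le`). Write 10 for `[true, false]`. A word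
containing 10 as a subword is determined by its permutation (`ofWord_injective`); all other words
give identities.

The interval below such a permutation thus consists of the subwords containing 10 and a chain of
identities. The Möbius values on the chain sum to zero unless the chain is a single point, so on
words containing 10 the function μ(1, ·) obeys the recurrence of the subword order based at 10, up
to a global sign. Björner's formula (`sum_normalCount`) solves it: |μ| counts the normal embeddings
of 10, those using every letter that equals its predecessor, and the sign depends only on the length
(`mu_ofWord`).

Repeated letters of the word are exactly the adjacency pairs of the permutation
(`repeats_eq_image`). So |μ| is the number of pairs a < b with letters 1, 0 that cover all repeats.
Two indices with different letters cannot cover many repeats, which gives the vanishing cases; the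
rest is counting in a word that alternates away from its repeats. -/

namespace SubwordOrder

/-! ### Subwords, normal embeddings and Björner's formula -/

variable {α : Type*} [DecidableEq α]

/-- The part of a word that follows the first occurrence of a letter. -/
def after (c : α) : List α → List α
  | [] => []
  | x :: w => if x = c then w else after c w

theorem length_after_lt {c : α} {w : List α} (h : c ∈ w) : (after c w).length < w.length := by
  induction w with
  | nil => simp at h
  | cons x w ih =>
    by_cases hx : x = c
    · simp [after, hx]
    · have : c ∈ w := by simpa [Ne.symm hx] using h
      simpa [after, hx] using (ih this).trans (Nat.lt_succ_self _)

theorem cons_sublist_iff_after {c : α} {u w : List α} :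
    (c :: u).Sublist w ↔ c ∈ w ∧ u.Sublist (after c w) := by
  induction w with
  | nil => simp
  | cons x w ih =>
    by_cases hx : x = c
    · subst hx
      simp [after]
    · rw [List.sublist_cons_iff]
      simp [after, hx, Ne.symm hx, ih]

/-- A suffix starting with `c` starts either at the first occurrence of `c` or strictly after it. -/
theorem cons_suffix_iff_after {c : α} {v w : List α} :
    (c :: v) <:+ w ↔ c ∈ w ∧ (v = after c w ∨ (c :: v) <:+ after c w) := by
  induction w with
  | nil => simp
  | cons x w ih =>
    by_cases hx : x = c
    · subst hx
      simp [after, List.suffix_cons_iff]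
    · simp [after, hx, Ne.symm hx, ih, List.suffix_cons_iff]

/-- The finite set of the subwords of a word. -/
def subwords (w : List α) : Finset (List α) := w.sublists.toFinset

@[simp] theorem mem_subwords {u w : List α} : u ∈ subwords w ↔ u.Sublist w := by
  simp [subwords]

/-- Embedding the first letter `c` as far left as possible loses nothing, so the subwords starting
with `c` correspond to the subwords of what follows the first `c`. Each subword is counted once,
however many embeddings it has. -/
theorem sum_subwords [Fintype α] {M : Type*} [AddCommMonoid M] (f : List α → M) (w : List α) :
    ∑ u ∈ subwords w, f u =
      f [] + ∑ c : α, if c ∈ w then ∑ u ∈ subwords (after c w), f (c :: u) else 0 := by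
  have h : subwords w = insert [] ((Finset.univ.filter (· ∈ w)).biUnion
      fun c => (subwords (after c w)).image (List.cons c)) := by
    ext u
    cases u with
    | nil => simp
    | cons c u => simp [cons_sublist_iff_after]
  rw [h, Finset.sum_insert (by simp), Finset.sum_biUnion, Finset.sum_filter]
  · congr 1
    refine Finset.sum_congr rfl fun c _ => ?_
    split_ifs
    · exact Finset.sum_image (by simp)
    · rfl
  · intro c _ d _ hcd
    rw [Function.onFun, Finset.disjoint_left]
    simp only [Finset.mem_image, not_exists, not_and]
    rintro _ ⟨u, _, rfl⟩ t _ ht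
    exact hcd (List.cons.inj ht).1.symm

/-- The number of normal embeddings of the word `v` in the word `u` preceded by the letter `p`:
the embeddings that use every letter of `u` which is equal to the letter before it. -/
def normalCount : List α → Option α → List α → ℤ
  | [], _, [] => 1
  | _ :: _, _, [] => 0
  | [], p, c :: u => if p = some c then 0 else normalCount [] (some c) u
  | x :: v, p, c :: u => (if p = some c then 0 else normalCount (x :: v) (some c) u) +
      if x = c then normalCount v (some c) u else 0

theorem normalCount_eq_zero {v u : List α} (p : Option α) (h : ¬ v.Sublist u) :
    normalCount v p u = 0 := by
  induction u generalizing v p with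
  | nil =>
    cases v with
    | nil => simp at h
    | cons x v => rfl
  | cons c u ih =>
    cases v with
    | nil => simp at h
    | cons x v =>
      rw [normalCount, ih _ fun h' => h (h'.cons c)]
      by_cases hx : x = c
      · subst hx
        rw [ih _ fun h' => h (h'.cons_cons x)]
        simp
      · simp [hx]

/-- The sum of the signed numbers of normal embeddings of `v` over all subwords of `w`. -/
def signedSum (v : List α) (p : Option α) (w : List α) : ℤ :=
  ∑ u ∈ subwords w, (-1) ^ u.length * normalCount v p u

/-- A proper suffix is preceded by exactly one letter. -/
theorem sum_cons_suffix [Fintype α] (v w : List α) :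
    (∑ c : α, if (c :: v) <:+ w then (1 : ℤ) else 0) = if v <:+ w ∧ v ≠ w then 1 else 0 := by
  split_ifs with h
  · obtain ⟨⟨t, rfl⟩, hne⟩ := h
    obtain ⟨t, a, rfl⟩ : ∃ s a, t = s ++ [a] :=
      ⟨_, _, (List.dropLast_append_getLast (by rintro rfl; simp at hne)).symm⟩
    rw [Finset.sum_eq_single a]
    · simp
    · intro b _ hb
      rw [if_neg]
      intro hs
      have h2 : (a :: v) <:+ t ++ [a] ++ v := by simp
      exact hb (List.cons.inj ((List.suffix_or_suffix_of_suffix hs h2).elim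
        (fun h => h.eq_of_length (by simp)) fun h => (h.eq_of_length (by simp)).symm)).1
    · simp
  · refine Finset.sum_eq_zero fun c _ => if_neg fun hc => h ⟨(List.suffix_cons c v).trans hc, ?_⟩
    rintro rfl
    simpa using hc.length_le

/-- Björner's formula strengthened so that induction on the length of `w` works: after a first
letter `c` is removed, the remaining subword must remember `c` as its predecessor. The suffix term
is the correction caused by a predecessor; it vanishes for `p = none`. -/
theorem signedSum_eq [Fintype α] (v : List α) (p : Option α) (w : List α) :
    signedSum v p w = (-1) ^ v.length * ((if v = w then 1 else 0) +
      ∑ c : α, if p = some c ∧ (c :: v) <:+ w then 1 else 0) := by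
  induction hn : w.length using Nat.strong_induction_on generalizing v p w with
  | _ n ih =>
  -- By induction the tail contributes either as `v` itself or through the suffix `c :: v`; the two
  -- alternatives merge into one suffix condition on `w`.
  have key (v : List α) (c : α) : (if c ∈ w then signedSum v (some c) (after c w) else 0) =
      (-1) ^ v.length * if (c :: v) <:+ w then 1 else 0 := by
    by_cases hc : c ∈ w
    · rw [if_pos hc, ih _ (hn ▸ length_after_lt hc) v (some c) _ rfl,
        Finset.sum_eq_single c (by intro b _ hb; simp [Ne.symm hb]) (by simp)]
      simp only [cons_suffix_iff_after (w := w), hc, true_and]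
      by_cases h1 : v = after c w
      · subst h1
        have : ¬ (c :: after c w) <:+ after c w := fun h => by simpa using h.length_le
        simp [this]
      · simp [h1]
    · rw [if_neg hc, if_neg fun h => hc (cons_suffix_iff_after.1 h).1, mul_zero]
  have hsplit : (∑ c : α, if p = some c ∧ (c :: v) <:+ w then (1 : ℤ) else 0) =
      (∑ c : α, if (c :: v) <:+ w then (1 : ℤ) else 0) -
        ∑ c : α, if p = some c then 0 else if (c :: v) <:+ w then (1 : ℤ) else 0 := by
    rw [← Finset.sum_sub_distrib]
    refine Finset.sum_congr rfl fun c _ => ?_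
    split_ifs <;> simp_all
  have hfirst (v : List α) : (∑ c : α, if c ∈ w then
      -(if p = some c then 0 else signedSum v (some c) (after c w)) else 0) =
      -((-1) ^ v.length *
        ∑ c : α, if p = some c then 0 else if (c :: v) <:+ w then (1 : ℤ) else 0) := by
    rw [Finset.mul_sum, ← Finset.sum_neg_distrib]
    refine Finset.sum_congr rfl fun c _ => ?_
    by_cases hp : p = some c
    · simp [hp]
    · have := key v c
      simp only [hp, if_false]
      rw [← this]
      split_ifs <;> simp
  rw [hsplit, sum_cons_suffix]
  cases v with
  | nil =>
    have h1 : signedSum [] p w = 1 + ∑ c : α, if c ∈ w then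
        -(if p = some c then 0 else signedSum [] (some c) (after c w)) else 0 := by
      rw [signedSum, sum_subwords]
      congr 1
      refine Finset.sum_congr rfl fun c _ => if_congr Iff.rfl ?_ rfl
      rw [signedSum]
      split_ifs with hp
      · simp [normalCount, hp]
      · simp [normalCount, hp, pow_succ]
    rw [h1, hfirst]
    by_cases hw : [] = w
    · subst hw
      simp
    · simp [hw]
      ring
  | cons x v =>
    -- The first letter `c` of the subword is either left unused, which is allowed only if it
    -- differs from `p`, or matched with `x`. Each removed letter flips the sign.
    have h1 : signedSum (x :: v) p w = (∑ c : α, if c ∈ w then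
        -(if p = some c then 0 else signedSum (x :: v) (some c) (after c w)) else 0) -
        if x ∈ w then signedSum v (some x) (after x w) else 0 := by
      have hx : (if x ∈ w then signedSum v (some x) (after x w) else 0) =
          ∑ c : α, if x = c then (if c ∈ w then signedSum v (some c) (after c w) else 0) else 0 := by
        simp
      rw [hx, ← Finset.sum_sub_distrib, signedSum, sum_subwords]
      simp only [normalCount, mul_zero, zero_add]
      refine Finset.sum_congr rfl fun c _ => ?_
      by_cases hc : c ∈ w
      · simp only [hc, if_true, signedSum, List.length_cons, pow_succ]
        by_cases hp : p = some c <;> by_cases hxc : x = c <;>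
          simp [hp, hxc, mul_add, Finset.sum_add_distrib] <;> ring
      · simp [hc]
    rw [h1, hfirst, key]
    by_cases hw : x :: v = w
    · subst hw
      simp [pow_succ]
      ring
    · by_cases hs : (x :: v) <:+ w <;> simp [hw, hs, pow_succ] <;> ring

/-- Björner's formula for the Möbius function of the subword order, as a recurrence. -/
theorem sum_normalCount [Fintype α] (v w : List α) :
    ∑ u ∈ subwords w, (-1) ^ u.length * normalCount v none u =
      if v = w then (-1) ^ v.length else 0 := by
  simpa [signedSum] using signedSum_eq v none w

end SubwordOrder

/-! ### Permutations with at most one descent as binary words -/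

namespace FinPerm

open SubwordOrder

/-- The permutation that lists the positions of the letters `false` of a binary word in increasing
order, followed by the positions of the letters `true` in increasing order. -/
def ofWord (w : List Bool) : FinPerm := ⟨w.length, Tuple.sort w.get⟩

theorem ofWord_ofFn {m : ℕ} (u : Fin m → Bool) : ofWord (List.ofFn u) = ⟨m, Tuple.sort u⟩ := by
  have key : ∀ (l : List Bool) (m : ℕ) (h : l.length = m),
      ofWord l = ⟨m, Tuple.sort fun i : Fin m => l.get (i.cast h.symm)⟩ := by
    rintro l _ rfl
    rfl
  rw [key _ m (by simp)]
  simp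

/-- Stability of the sort: entries are ordered lexicographically by letter, then by index. -/
theorem sort_symm_lt_iff {α : Type*} [LinearOrder α] {n : ℕ} (f : Fin n → α) (i j : Fin n) :
    i < j ↔ f (Tuple.sort f i) < f (Tuple.sort f j) ∨
      f (Tuple.sort f i) = f (Tuple.sort f j) ∧ Tuple.sort f i < Tuple.sort f j := by
  have h := Tuple.eq_sort_iff'.1 (rfl : Tuple.sort f = Tuple.sort f)
  rw [← h.lt_iff_lt]
  exact Prod.Lex.toLex_lt_toLex

theorem ofWord_mono {u w : List Bool} (h : u.Sublist w) : ofWord u ≤ ofWord w := by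
  obtain ⟨g, hg⟩ := List.sublist_iff_exists_fin_orderEmbedding_get_eq.1 h
  have key : ∃ f : Fin u.length → Fin w.length, StrictMono f ∧ ∀ i j,
      Tuple.sort u.get i < Tuple.sort u.get j ↔
        Tuple.sort w.get (f i) < Tuple.sort w.get (f j) := by
    refine ⟨fun i => (Tuple.sort w.get).symm (g (Tuple.sort u.get i)), fun i j hij => ?_,
      fun i j => ?_⟩
    · rw [sort_symm_lt_iff w.get]
      simpa only [Equiv.apply_symm_apply, ← hg, g.lt_iff_lt] using (sort_symm_lt_iff u.get i j).1 hij
    · simp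
  exact key

theorem ofFn_comp_sublist {α : Type*} {m : ℕ} (w : List α) (g : Fin m → Fin w.length)
    (hg : StrictMono g) : (List.ofFn (w.get ∘ g)).Sublist w := by
  refine List.sublist_iff_exists_fin_orderEmbedding_get_eq.2
    ⟨OrderEmbedding.ofStrictMono (fun i => g (i.cast (by simp))) fun i j hij => hg hij, ?_⟩
  intro i
  simp
  rfl

/-- An occurrence of `σ` selects a set of values. Reading `w` at these values in increasing order
gives the subword, since stable sorting is compatible with restriction. -/
theorem exists_word_of_le {σ : FinPerm} {w : List Bool} (h : σ ≤ ofWord w) :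
    ∃ u, u.Sublist w ∧ ofWord u = σ := by
  obtain ⟨m, s⟩ := σ
  obtain ⟨f, hf, hf'⟩ := h
  change Fin m → Fin w.length at f
  change ∀ i j, s i < s j ↔ Tuple.sort w.get (f i) < Tuple.sort w.get (f j) at hf'
  have hg : StrictMono fun v => Tuple.sort w.get (f (s.symm v)) := fun a b hab =>
    (hf' _ _).1 (by simpa using hab)
  refine ⟨_, ofFn_comp_sublist w _ hg, ?_⟩
  rw [ofWord_ofFn]
  congr 1
  refine (Tuple.eq_sort_iff.2 ⟨fun i j hij => ?_, fun i j hij he => ?_⟩).symm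
  · simpa using (Tuple.eq_sort_iff.1 (rfl : Tuple.sort w.get = _)).1 (hf.monotone hij)
  · exact (hf' i j).2 ((Tuple.eq_sort_iff.1 (rfl : Tuple.sort w.get = _)).2 _ _ (hf hij)
      (by simpa using he))

theorem pair_sublist_iff {w : List Bool} : [true, false].Sublist w ↔ ¬ Monotone w.get := by
  rw [List.sublist_iff_exists_fin_orderEmbedding_get_eq]
  constructor
  · rintro ⟨f, hf⟩ h
    have h01 : f ⟨0, by simp⟩ ≤ f ⟨1, by simp⟩ := f.monotone (by simp)
    have := h h01
    rw [← hf, ← hf] at this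
    exact absurd this (by decide)
  · intro h
    obtain ⟨a, b, hab, hlt⟩ : ∃ a b, a ≤ b ∧ w.get b < w.get a := by
      simpa [Monotone] using h
    have hne : a < b := lt_of_le_of_ne hab (by rintro rfl; exact lt_irrefl _ hlt)
    obtain ⟨hb, ha⟩ := Bool.lt_iff.1 hlt
    refine ⟨OrderEmbedding.ofStrictMono (fun i => if (i : ℕ) = 0 then a else b) ?_, ?_⟩
    · rintro ⟨i, hi⟩ ⟨j, hj⟩ hij
      have hi' : i < 2 := hi
      have hj' : j < 2 := hj
      have hij' : i < j := hij
      obtain rfl : i = 0 := by omega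
      obtain rfl : j = 1 := by omega
      simpa using hne
    · rintro ⟨i, hi⟩
      have hi' : i < 2 := hi
      interval_cases i <;> simp_all

theorem ofWord_eq_of_monotone {w : List Bool} (h : ¬ [true, false].Sublist w) :
    ofWord w = ⟨w.length, Equiv.refl _⟩ := by
  rw [ofWord, Tuple.sort_eq_refl_iff_monotone.2 (by simpa [pair_sublist_iff] using h)]

/-- Suppose the words differ at an entry placed at position `i` by the common sort. Then one word is
`false` at all positions up to `i`, the other is `true` from `i` on, so the sort increases on both
sides of `i`. It is the identity, and the words are monotone. -/
theorem sort_injective {n : ℕ} {u v : Fin n → Bool} (h : Tuple.sort u = Tuple.sort v)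
    (hu : ¬ Monotone u) : u = v := by
  by_contra hne
  have key : ∀ (u v : Fin n → Bool), Tuple.sort u = Tuple.sort v → ∀ a, u a = false →
      v a = true → Monotone u := by
    intro u v h a hua hva
    rw [← Tuple.sort_eq_refl_iff_monotone]
    set s := Tuple.sort u with hs
    have hsu := Tuple.eq_sort_iff.1 hs
    have hsv := Tuple.eq_sort_iff.1 (hs.trans h)
    obtain ⟨i, rfl⟩ := s.surjective a
    have h1 : ∀ j ≤ i, u (s j) = false := fun j hj =>
      le_antisymm ((hsu.1 hj).trans hua.le) (Bool.false_le _)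
    have h2 : ∀ j, i ≤ j → v (s j) = true := fun j hj =>
      le_antisymm (Bool.le_true _) (hva.ge.trans (hsv.1 hj))
    have hm : StrictMono s := by
      have low : ∀ j k, j < k → k ≤ i → s j < s k := fun j k hjk hk =>
        hsu.2 j k hjk ((h1 j (hjk.le.trans hk)).trans (h1 k hk).symm)
      have high : ∀ j k, j < k → i ≤ j → s j < s k := fun j k hjk hj =>
        hsv.2 j k hjk ((h2 j hj).trans (h2 k (hj.trans hjk.le)).symm)
      -- The two increasing ranges share the index `i`, so a pair straddling it is compared through
      -- `i`.
      intro j k hjk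
      rcases le_total k i with hk | hk
      · exact low j k hjk hk
      rcases le_total i j with hj | hj
      · exact high j k hjk hj
      rcases hj.eq_or_lt with rfl | hj
      · exact high _ _ hjk le_rfl
      rcases hk.eq_or_lt with rfl | hk
      · exact low _ _ hjk le_rfl
      · exact (low _ _ hj le_rfl).trans (high _ _ hk le_rfl)
    have e : hm.orderIsoOfSurjective s s.surjective = OrderIso.refl _ := Subsingleton.elim _ _
    ext x
    exact congrArg (fun g : Fin n ≃o Fin n => (g x : ℕ)) e
  obtain ⟨a, ha⟩ := Function.ne_iff.1 hne
  cases hua : u a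
  · exact hu (key u v h a hua (by simpa [hua] using ha))
  · have := key v u h.symm a (by simpa [hua] using ha) hua
    rw [← Tuple.sort_eq_refl_iff_monotone, ← h, Tuple.sort_eq_refl_iff_monotone] at this
    exact hu this

theorem ofWord_injective {u v : List Bool} (h : ofWord u = ofWord v)
    (hu : [true, false].Sublist u) : u = v := by
  have hl : u.length = v.length := congrArg length h
  have key : ∀ n (u v : Fin n → Bool), ¬ Monotone u →
      (⟨n, Tuple.sort u⟩ : FinPerm) = ⟨n, Tuple.sort v⟩ → u = v := by
    intro n u v hu h
    exact sort_injective (by simpa using h) hu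
  have hv : ofWord v = ⟨u.length, Tuple.sort fun i : Fin u.length => v.get (i.cast hl)⟩ := by
    conv_lhs => rw [← List.ofFn_get v]
    rw [List.ofFn_congr hl.symm, ofWord_ofFn]
  rw [hv] at h
  have := key _ _ _ (pair_sublist_iff.1 hu) h
  refine List.ext_get hl fun i h1 h2 => ?_
  exact congrFun this ⟨i, h1⟩

theorem one_le_iff {σ : FinPerm} : one ≤ σ ↔ 0 < σ.length := by
  refine ⟨fun h => (Nat.zero_lt_one).trans_le (length_le h), fun h => ?_⟩
  refine ⟨fun _ => ⟨0, h⟩, fun i j hij => ?_, fun i j => ?_⟩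
  · have hi : (i : ℕ) < 1 := i.2
    have hj : (j : ℕ) < 1 := j.2
    have : (i : ℕ) < j := hij
    omega
  · have : i = j := Fin.ext (by
      have hi : (i : ℕ) < 1 := i.2
      have hj : (j : ℕ) < 1 := j.2
      omega)
    simp [this]

theorem ofWord_replicate (m : ℕ) : ofWord (List.replicate m false) = ⟨m, Equiv.refl _⟩ := by
  have h : ¬ [true, false].Sublist (List.replicate m false) := fun h => by
    simpa using h.subset (List.mem_cons_self)
  rw [ofWord_eq_of_monotone h, List.length_replicate]

theorem mk_refl_le_iff {σ : FinPerm} {m : ℕ} :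
    σ ≤ ⟨m, Equiv.refl _⟩ ↔ ∃ k ≤ m, σ = ⟨k, Equiv.refl _⟩ := by
  rw [← ofWord_replicate]
  constructor
  · intro h
    obtain ⟨u, hu, rfl⟩ := exists_word_of_le h
    obtain ⟨k, hk, rfl⟩ := List.sublist_replicate_iff.1 hu
    exact ⟨k, hk, ofWord_replicate k⟩
  · rintro ⟨k, hk, rfl⟩
    rw [← ofWord_replicate]
    exact ofWord_mono ((List.replicate_sublist_replicate _).2 hk)

/-- The defining recurrence of μ with the identities removed: their contribution is the sum of μ
over a chain starting at 1, which is zero unless the chain is just 1. -/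
theorem sum_mu_pair_sublist {w : List Bool} (hw : [true, false].Sublist w) :
    ∑ u ∈ (subwords w).filter ([true, false].Sublist ·), IncidenceAlgebra.mu ℤ one (ofWord u) =
      -if w = [true, false] then 1 else 0 := by
  have hlen : 2 ≤ w.length := hw.length_le
  -- The longest subword avoiding 10 gives the largest identity below the permutation, hence the top
  -- of the chain.
  obtain ⟨x, hx, hmax⟩ := ((subwords w).filter (¬ [true, false].Sublist ·)).exists_max_image
    List.length ⟨[true], by
      simp only [Finset.mem_filter, mem_subwords]
      exact ⟨(by simp : [true].Sublist [true, false]).trans hw, by decide⟩⟩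
  simp only [Finset.mem_filter, mem_subwords] at hx hmax
  have hIcc : Finset.Icc one (ofWord w) =
      ((subwords w).filter ([true, false].Sublist ·)).image ofWord ∪
        Finset.Icc one ⟨x.length, Equiv.refl _⟩ := by
    ext σ
    simp only [Finset.mem_Icc, Finset.mem_union, Finset.mem_image, Finset.mem_filter, mem_subwords]
    constructor
    · rintro ⟨h1, h2⟩
      obtain ⟨u, hu, rfl⟩ := exists_word_of_le h2
      by_cases hp : [true, false].Sublist u
      · exact Or.inl ⟨u, ⟨hu, hp⟩, rfl⟩
      · exact Or.inr ⟨h1, mk_refl_le_iff.2 ⟨_, hmax u ⟨hu, hp⟩, ofWord_eq_of_monotone hp⟩⟩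
    · rintro (⟨u, ⟨hu, hp⟩, rfl⟩ | ⟨h1, h2⟩)
      · exact ⟨one_le_iff.2 (Nat.zero_lt_two.trans_le hp.length_le), ofWord_mono hu⟩
      · refine ⟨h1, h2.trans ?_⟩
        rw [← ofWord_eq_of_monotone hx.2]
        exact ofWord_mono hx.1
  have hdisj : Disjoint (((subwords w).filter ([true, false].Sublist ·)).image ofWord)
      (Finset.Icc one ⟨x.length, Equiv.refl _⟩) := by
    rw [Finset.disjoint_left]
    simp only [Finset.mem_image, Finset.mem_filter, Finset.mem_Icc, not_and]
    rintro _ ⟨u, ⟨-, hp⟩, rfl⟩ - h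
    obtain ⟨k, -, hk⟩ := mk_refl_le_iff.1 h
    rw [← ofWord_replicate] at hk
    have := ofWord_injective hk hp
    rw [this] at hp
    simpa using hp.subset (List.mem_cons_self)
  have hne : one ≠ ofWord w := fun h => by
    have : 1 = w.length := congrArg length h
    omega
  have hx1 : one = ⟨x.length, Equiv.refl _⟩ ↔ w = [true, false] := by
    have h1 : one = ⟨x.length, Equiv.refl _⟩ ↔ x.length = 1 := by
      constructor
      · intro h
        exact (congrArg length h).symm
      · intro h
        rw [h]
        rfl
    rw [h1]
    constructor
    · intro h
      by_contra hw'
      have h3 : 3 ≤ w.length := by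
        by_contra h3
        exact hw' (hw.eq_of_length (by simp; omega)).symm
      -- Among any three binary letters, two form a subword other than 10. So the chain is trivial
      -- only for 10 itself.
      obtain ⟨u, hu, hp, hl⟩ : ∃ u, u.Sublist w ∧ ¬ [true, false].Sublist u ∧ u.length = 2 := by
        match w, h3 with
        | a :: b :: c :: w, _ =>
          have h0 : [a, b, c].Sublist (a :: b :: c :: w) := by simp
          obtain ⟨u, hu, hp⟩ : ∃ u, u.Sublist [a, b, c] ∧
              ¬ [true, false].Sublist u ∧ u.length = 2 := by
            rcases a <;> rcases b
            · exact ⟨[false, false], by simp, by decide, rfl⟩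
            · exact ⟨[false, true], by simp, by decide, rfl⟩
            · rcases c
              · exact ⟨[false, false], by simp, by decide, rfl⟩
              · exact ⟨[false, true], by simp, by decide, rfl⟩
            · exact ⟨[true, true], by simp, by decide, rfl⟩
          exact ⟨u, hu.trans h0, hp⟩
      have := hmax u ⟨hu, hp⟩
      omega
    · rintro rfl
      have h1 := hmax [true] ⟨by simp, by decide⟩
      have h2 := hx.1.length_le
      have h3 : x.length ≠ 2 := fun h => hx.2 (hx.1.eq_of_length h ▸ List.Sublist.refl _)
      simp at h1 h2
      omega
  have hsum := IncidenceAlgebra.sum_Icc_mu_right (𝕜 := ℤ) one (ofWord w)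
  rw [if_neg hne, hIcc, Finset.sum_union hdisj, IncidenceAlgebra.sum_Icc_mu_right,
    Finset.sum_image, if_congr hx1 rfl rfl] at hsum
  · linarith
  · intro u hu v _ h
    exact ofWord_injective h (Finset.mem_filter.1 hu).2

/-- Both sides satisfy the same recurrence over the subwords containing 10, which determines them by
induction on length; words avoiding 10 have no embedding and drop out of Björner's sum. -/
theorem mu_ofWord {w : List Bool} (hw : [true, false].Sublist w) :
    IncidenceAlgebra.mu ℤ one (ofWord w) =
      (-1) ^ (w.length + 1) * normalCount [true, false] none w := by
  induction hn : w.length using Nat.strong_induction_on generalizing w with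
  | _ n ih =>
  have h1 := sum_mu_pair_sublist hw
  have h2 := sum_normalCount [true, false] w
  rw [← Finset.sum_filter_of_ne (p := fun u => [true, false].Sublist u)] at h2
  · have hmem : w ∈ (subwords w).filter ([true, false].Sublist ·) := by simp [hw]
    rw [← Finset.add_sum_erase _ _ hmem] at h1 h2
    have h3 : ∑ u ∈ ((subwords w).filter ([true, false].Sublist ·)).erase w,
        IncidenceAlgebra.mu ℤ one (ofWord u) =
        -∑ u ∈ ((subwords w).filter ([true, false].Sublist ·)).erase w,
          (-1) ^ u.length * normalCount [true, false] none u := by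
      rw [← Finset.sum_neg_distrib]
      refine Finset.sum_congr rfl fun u hu => ?_
      simp only [Finset.mem_erase, Finset.mem_filter, mem_subwords] at hu
      have hlt : u.length < n := hn ▸ lt_of_le_of_ne hu.2.1.length_le
        fun h => hu.1 (hu.2.1.eq_of_length h)
      rw [ih _ hlt hu.2.2 rfl]
      ring
    rw [h3] at h1
    rw [← hn]
    have h4 : (if w = [true, false] then (1 : ℤ) else 0) =
        if [true, false] = w then (-1) ^ [true, false].length else 0 :=
      if_congr eq_comm (by simp) rfl
    rw [pow_succ]
    linarith
  · intro u _ hu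
    by_contra hp
    exact hu (by rw [normalCount_eq_zero none hp, mul_zero])

end FinPerm

/-! ### Normal embeddings of 10 as pairs of indices -/

namespace SubwordOrder

variable {α : Type*}

/-- The letter at position `r` of the word `p W₀ W₁ …` (where `p` is at position `-1`) is equal to
the letter before it. -/
def RepeatsAt (p : Option α) (W : ℕ → α) : ℕ → Prop
  | 0 => p = some (W 0)
  | r + 1 => W r = W (r + 1)

theorem repeatsAt_shift (p : Option α) (W : ℕ → α) (r : ℕ) :
    RepeatsAt (some (W 0)) (fun i => W (i + 1)) r ↔ RepeatsAt p W (r + 1) := by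
  cases r <;> simp [RepeatsAt]

theorem forall_lt_repeatsAt_shift (p : Option α) (W : ℕ → α) (n : ℕ) (P : ℕ → Prop) :
    (∀ r < n + 1, RepeatsAt p W r → P r) ↔ (p = some (W 0) → P 0) ∧
      ∀ r < n, RepeatsAt (some (W 0)) (fun i => W (i + 1)) r → P (r + 1) := by
  simp only [repeatsAt_shift p]
  constructor
  · exact fun h => ⟨h 0 (by simp), fun r hr => h _ (by omega)⟩
  · rintro ⟨h0, h⟩ (_ | r) hr
    · exact h0
    · exact h r (by omega)

/-- The finite word `W₀ W₁ … Wₙ₋₁`. -/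
def word (W : ℕ → α) (n : ℕ) : List α := List.ofFn fun i : Fin n => W i

theorem word_succ (W : ℕ → α) (n : ℕ) :
    word W (n + 1) = W 0 :: word (fun i => W (i + 1)) n := by
  simp [word, List.ofFn_succ]

variable [DecidableEq α]

instance (p : Option α) (W : ℕ → α) (r : ℕ) : Decidable (RepeatsAt p W r) := by
  cases r <;> exact inferInstanceAs (Decidable (_ = _))

theorem normalCount_nil (p : Option α) (W : ℕ → α) (n : ℕ) :
    normalCount [] p (word W n) = if ∀ r < n, RepeatsAt p W r → False then 1 else 0 := by
  induction n generalizing p W with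
  | zero => simp [word, normalCount]
  | succ n ih =>
    rw [word_succ, normalCount, ih]
    simp only [forall_lt_repeatsAt_shift p W n]
    by_cases hp : p = some (W 0)
    · simp [hp]
    · simp [hp]

theorem normalCount_singleton (x : α) (p : Option α) (W : ℕ → α) (n : ℕ) :
    normalCount [x] p (word W n) = ∑ b ∈ Finset.range n,
      if W b = x ∧ ∀ r < n, RepeatsAt p W r → r = b then 1 else 0 := by
  induction n generalizing p W with
  | zero => simp [word, normalCount]
  | succ n ih =>
    rw [word_succ, normalCount, ih, normalCount_nil, Finset.sum_range_succ']
    simp only [forall_lt_repeatsAt_shift p W n, Nat.add_right_cancel_iff, Nat.succ_ne_zero]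
    congr 1
    · by_cases hp : p = some (W 0)
      · simp [hp]
      · simp [hp]
    · by_cases hx : x = W 0
      · simp [hx]
      · simp [hx, Ne.symm hx]

/-- The recursion on the first letter separates the pairs with `a = 0`, which leave a one-letter
count, from those with `a > 0`, which are pairs in the shifted word. -/
theorem normalCount_pair (x y : α) (p : Option α) (W : ℕ → α) (n : ℕ) :
    normalCount [x, y] p (word W n) = ∑ a ∈ Finset.range n, ∑ b ∈ Finset.range n,
      if a < b ∧ W a = x ∧ W b = y ∧ ∀ r < n, RepeatsAt p W r → r = a ∨ r = b then 1 else 0 := by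
  induction n generalizing p W with
  | zero => simp [word, normalCount]
  | succ n ih =>
    rw [word_succ, normalCount, ih, normalCount_singleton, Finset.sum_range_succ']
    simp only [Finset.sum_range_succ', forall_lt_repeatsAt_shift p W n, Nat.add_right_cancel_iff,
      Nat.succ_ne_zero, Nat.add_lt_add_iff_right]
    congr 1
    · by_cases hp : p = some (W 0)
      · simp [hp]
      · simp [hp]
    · by_cases hx : x = W 0
      · simp [hx]
      · simp [hx, Ne.symm hx]

/-- The indices of the letters of `W₀ W₁ … Wₙ₋₁` that are equal to the letter before them. -/
def repeats (W : ℕ → α) (n : ℕ) : Finset ℕ := {r ∈ Finset.Ico 1 n | W (r - 1) = W r}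

/-- The pairs of indices at which the letters `true`, `false` have a normal embedding. -/
def normalPairs (W : ℕ → Bool) (n : ℕ) : Finset (ℕ × ℕ) :=
  {q ∈ Finset.range n ×ˢ Finset.range n |
    q.1 < q.2 ∧ W q.1 = true ∧ W q.2 = false ∧ repeats W n ⊆ {q.1, q.2}}

theorem normalCount_eq_card (W : ℕ → Bool) (n : ℕ) :
    normalCount [true, false] none (word W n) = (normalPairs W n).card := by
  rw [normalCount_pair, normalPairs, Finset.card_filter, Finset.sum_product, Nat.cast_sum]
  refine Finset.sum_congr rfl fun a _ => ?_
  rw [Nat.cast_sum]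
  refine Finset.sum_congr rfl fun b _ => ?_
  have h : (∀ r < n, RepeatsAt none W r → r = a ∨ r = b) ↔ repeats W n ⊆ {a, b} := by
    simp only [Finset.subset_iff, repeats, Finset.mem_filter, Finset.mem_Ico, Finset.mem_insert,
      Finset.mem_singleton]
    constructor
    · rintro h (_ | r) ⟨⟨h1, h2⟩, h3⟩
      · simp at h1
      · exact h _ h2 h3
    · rintro h (_ | r) h1 h2
      · simp [RepeatsAt] at h2
      · exact h ⟨⟨by simp, h1⟩, h2⟩
  simp [h]

/-- The number of letters `false` among the first `m` letters of a binary word. -/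
def countFalse (W : ℕ → Bool) (m : ℕ) : ℕ := Nat.count (fun a => W a = false) m

@[simp] theorem countFalse_zero (W : ℕ → Bool) : countFalse W 0 = 0 := Nat.count_zero _

theorem countFalse_succ (W : ℕ → Bool) (m : ℕ) :
    countFalse W (m + 1) = countFalse W m + if W m = false then 1 else 0 := Nat.count_succ _ _

theorem countFalse_mono (W : ℕ → Bool) : Monotone (countFalse W) := Nat.count_monotone _

theorem countFalse_le (W : ℕ → Bool) (m : ℕ) : countFalse W m ≤ m := Nat.count_le _

theorem countFalse_sub_le (W : ℕ → Bool) {k m : ℕ} (h : k ≤ m) :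
    countFalse W m + k ≤ countFalse W k + m := by
  induction m, h using Nat.le_induction with
  | base => rfl
  | succ m _ ih =>
    rw [countFalse_succ]
    split_ifs <;> omega

theorem card_filter_true (W : ℕ → Bool) {b n : ℕ} (hb : b ≤ n) :
    ({a ∈ Finset.range n | a < b ∧ W a = true} : Finset ℕ).card = b - countFalse W b := by
  have h1 : ({a ∈ Finset.range n | a < b ∧ W a = true} : Finset ℕ) =
      {a ∈ Finset.range b | ¬ W a = false} := by
    ext a
    simp
    omega
  have h2 := Finset.card_filter_add_card_filter_not (s := Finset.range b) (fun a => W a = false)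
  rw [h1, countFalse, Nat.count_eq_card_filter_range]
  rw [Finset.card_range] at h2
  omega

theorem card_filter_false (W : ℕ → Bool) {b n : ℕ} (hb : b ≤ n) :
    ({a ∈ Finset.range n | b ≤ a ∧ W a = false} : Finset ℕ).card =
      countFalse W n - countFalse W b := by
  have h1 : ({a ∈ Finset.range n | W a = false} : Finset ℕ) =
      {a ∈ Finset.range b | W a = false} ∪ {a ∈ Finset.range n | b ≤ a ∧ W a = false} := by
    ext a
    simp only [Finset.mem_filter, Finset.mem_range, Finset.mem_union]
    by_cases hab : a < b
    · simp [hab, hab.trans_le hb]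
    · simp [hab, not_lt.1 hab]
  rw [countFalse, countFalse, Nat.count_eq_card_filter_range, Nat.count_eq_card_filter_range, h1,
    Finset.card_union_of_disjoint]
  · simp
  · rw [Finset.disjoint_left]
    simp only [Finset.mem_filter, Finset.mem_range]
    omega

/-- A word that alternates from the index `s` on. -/
theorem alternating {W : ℕ → Bool} {s m : ℕ} (h : ∀ k, s + k + 1 < m → W (s + k) ≠ W (s + k + 1))
    (k : ℕ) : (s + k < m → W (s + k) = if k % 2 = 0 then W s else !W s) ∧
      (s + k ≤ m → countFalse W (s + k) =
        countFalse W s + if W s = false then (k + 1) / 2 else k / 2) := by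
  induction k with
  | zero => simp
  | succ k ih =>
    refine ⟨fun hk => ?_, fun hk => ?_⟩
    · have h1 := h k hk
      have h2 := ih.1 (by omega)
      rw [← add_assoc]
      rcases Nat.mod_two_eq_zero_or_one k with hk2 | hk2
      · rw [if_pos hk2] at h2
        rw [if_neg (by omega)]
        rw [h2] at h1
        revert h1
        cases W s <;> cases W (s + k + 1) <;> simp
      · rw [if_neg (by omega)] at h2
        rw [if_pos (by omega)]
        rw [h2] at h1
        revert h1
        cases W s <;> cases W (s + k + 1) <;> simp
    · have h1 := ih.1 (by omega)
      have h2 := ih.2 (by omega)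
      rw [← add_assoc, countFalse_succ, h1, h2]
      rcases Nat.mod_two_eq_zero_or_one k with hk2 | hk2 <;> cases W s <;> simp [hk2] <;> omega

theorem alternating_zero {W : ℕ → Bool} {m : ℕ} (h : ∀ k, k + 1 < m → W k ≠ W (k + 1)) (k : ℕ) :
    (k < m → W k = if k % 2 = 0 then W 0 else !W 0) ∧
      (k ≤ m → countFalse W k = if W 0 = false then (k + 1) / 2 else k / 2) := by
  simpa using alternating (s := 0) (m := m) (by simpa using h) k

/-- Without repeats every occurrence of 10 is normal. Each `false` at `b` contributes the number of
`true` letters before it; in an alternating word these numbers are consecutive integers, and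
Pascal's rule sums them. -/
theorem card_normalPairs_of_repeats_eq_empty {W : ℕ → Bool} {n : ℕ} (h : repeats W n = ∅) :
    (normalPairs W n).card =
      if W 0 = false then ((n + 1) / 2).choose 2 else (n / 2 + 1).choose 2 := by
  have halt : ∀ k, k + 1 < n → W k ≠ W (k + 1) := by
    intro k hk he
    have : k + 1 ∈ repeats W n := by simp [repeats, hk, he]
    simp [h] at this
  have h1 : (normalPairs W n).card =
      ∑ b ∈ Finset.range n, if W b = false then b - countFalse W b else 0 := by
    rw [normalPairs, Finset.card_filter, Finset.sum_product_right]
    refine Finset.sum_congr rfl fun b hb => ?_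
    split_ifs with hW
    · rw [← card_filter_true W (Finset.mem_range.1 hb).le, Finset.card_filter]
      simp [h, hW]
    · simp [hW]
  rw [h1]
  have key : ∀ m ≤ n, (∑ b ∈ Finset.range m, if W b = false then b - countFalse W b else 0) =
      if W 0 = false then ((m + 1) / 2).choose 2 else (m / 2 + 1).choose 2 := by
    intro m
    induction m with
    | zero => simp
    | succ m ih =>
      intro hm
      obtain ⟨h2, h3⟩ := alternating_zero halt m
      rw [Finset.sum_range_succ, ih (by omega), h2 (by omega), h3 (by omega)]
      rcases Nat.even_or_odd' m with ⟨k, rfl | rfl⟩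
      · have e1 : (2 * k + 1 + 1) / 2 = k + 1 := by omega
        have e2 : (2 * k + 1) / 2 = k := by omega
        have e3 : 2 * k / 2 = k := by omega
        have e4 : 2 * k - k = k := by omega
        have e5 : (k + 1).choose 2 = k + k.choose 2 := by simp [Nat.choose_succ_succ' k 1]
        cases W 0
        · simp [e1, e2, e4]
          omega
        · simp [e2]
      · have e1 : (2 * k + 1 + 1 + 1) / 2 = k + 1 := by omega
        have e2 : (2 * k + 1) / 2 = k := by omega
        have e3 : (2 * k + 1 + 1) / 2 = k + 1 := by omega
        have e4 : 2 * k + 1 - k = k + 1 := by omega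
        have e5 : (k + 1 + 1).choose 2 = k + 1 + (k + 1).choose 2 := by
          simp [Nat.choose_succ_succ' (k + 1) 1]
        have e6 : (2 * k + 1) % 2 = 1 := by omega
        cases W 0 <;> simp [e1, e2, e3, e4, e6]
        omega
  exact key n le_rfl

/-- The repeat carries `false`, so it must be the second index; the first is any earlier `true`. -/
theorem card_normalPairs_of_repeats_eq_singleton_false {W : ℕ → Bool} {n r : ℕ}
    (h : repeats W n = {r}) (hr : W r = false) :
    (normalPairs W n).card = r - countFalse W r := by
  have hrn : r < n := by
    have : r ∈ repeats W n := by simp [h]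
    simp [repeats] at this
    omega
  rw [← card_filter_true W hrn.le,
    ← Finset.card_image_of_injective {a ∈ Finset.range n | a < r ∧ W a = true}
      (Prod.mk_left_injective r)]
  refine congrArg Finset.card ?_
  ext ⟨a, b⟩
  simp only [normalPairs, h, Finset.mem_filter, Finset.mem_product, Finset.mem_range,
    Finset.singleton_subset_iff, Finset.mem_insert, Finset.mem_singleton, Finset.mem_image,
    Prod.mk.injEq]
  constructor
  · rintro ⟨⟨ha, hb⟩, hab, hWa, hWb, rfl | rfl⟩
    · simp [hr] at hWa
    · exact ⟨a, ⟨ha, hab, hWa⟩, rfl, rfl⟩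
  · rintro ⟨a, ⟨ha, hab, hWa⟩, rfl, rfl⟩
    exact ⟨⟨ha, hrn⟩, hab, hWa, hr, Or.inr rfl⟩

theorem card_normalPairs_of_repeats_eq_singleton_true {W : ℕ → Bool} {n r : ℕ}
    (h : repeats W n = {r}) (hr : W r = true) :
    (normalPairs W n).card = countFalse W n - countFalse W r := by
  have hrn : r < n := by
    have : r ∈ repeats W n := by simp [h]
    simp [repeats] at this
    omega
  rw [← card_filter_false W hrn.le,
    ← Finset.card_image_of_injective {a ∈ Finset.range n | r ≤ a ∧ W a = false}
      (Prod.mk_right_injective r)]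
  refine congrArg Finset.card ?_
  ext ⟨a, b⟩
  simp only [normalPairs, h, Finset.mem_filter, Finset.mem_product, Finset.mem_range,
    Finset.singleton_subset_iff, Finset.mem_insert, Finset.mem_singleton, Finset.mem_image,
    Prod.mk.injEq]
  constructor
  · rintro ⟨⟨ha, hb⟩, hab, hWa, hWb, rfl | rfl⟩
    · exact ⟨b, ⟨hb, hab.le, hWb⟩, rfl, rfl⟩
    · simp [hr] at hWb
  · rintro ⟨b, ⟨hb, hab, hWb⟩, rfl, rfl⟩
    refine ⟨⟨hrn, hb⟩, lt_of_le_of_ne hab ?_, hr, hWb, Or.inl rfl⟩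
    rintro rfl
    simp [hr] at hWb

end SubwordOrder

/-! ### Adjacency pairs as repeated letters -/

open SubwordOrder

/-- The number of letters before the letter `v` in the permutation that lists the indices of the
letters `false` of `W₀ W₁ … Wₙ₋₁` and then those of the letters `true`. -/
def sortedPos (W : ℕ → Bool) (n v : ℕ) : ℕ :=
  if W v = true then countFalse W n + (v - countFalse W v) else countFalse W v

theorem sort_symm_apply (W : ℕ → Bool) {n : ℕ} (v : Fin n) :
    ((Tuple.sort fun i : Fin n => W i).symm v : ℕ) = sortedPos W n v := by
  set s := Tuple.sort fun i : Fin n => W i with hs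
  -- The position of `v` is found by counting the values listed before it.
  have h1 : ((Finset.Iio (s.symm v)).map s.toEmbedding).map Fin.valEmbedding =
      {a ∈ Finset.range n | W a < W v ∨ W a = W v ∧ a < v} := by
    ext a
    simp only [Finset.mem_map, Finset.mem_Iio, Finset.mem_filter, Finset.mem_range]
    constructor
    · rintro ⟨_, ⟨i, hi, rfl⟩, rfl⟩
      rw [FinPerm.sort_symm_lt_iff fun i : Fin n => W i, ← hs] at hi
      exact ⟨Fin.is_lt _, by simpa using hi⟩
    · rintro ⟨ha, h⟩
      refine ⟨⟨a, ha⟩, ⟨s.symm ⟨a, ha⟩, ?_, by simp⟩, rfl⟩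
      rw [FinPerm.sort_symm_lt_iff fun i : Fin n => W i, ← hs]
      simpa [Fin.lt_def] using h
  rw [← Fin.card_Iio, ← Finset.card_map s.toEmbedding, ← Finset.card_map Fin.valEmbedding, h1,
    sortedPos]
  cases hv : W v
  · have := Nat.count_eq_card_filter_range (fun a => W a = false) v
    simp only [countFalse, Bool.false_eq_true, if_false]
    rw [this]
    refine congrArg Finset.card ?_
    ext a
    cases hWa : W a <;> simp [hWa]
    omega
  · rw [if_pos rfl, ← card_filter_true W v.is_lt.le, countFalse, Nat.count_eq_card_filter_range,
      ← Finset.card_union_of_disjoint]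
    · refine congrArg Finset.card ?_
      ext a
      cases hWa : W a <;> simp [hWa]
    · rw [Finset.disjoint_left]
      intro a
      simp only [Finset.mem_filter]
      rintro ⟨-, h⟩ ⟨-, -, h'⟩
      simp [h] at h'

/-- The letters of `π` at the positions up to its only descent are those `v + 1` with
`W v = false`. -/
structure IsValueWord {n : ℕ} (π : Equiv.Perm (Fin n)) (W : ℕ → Bool) : Prop where
  eq_sort : π = Tuple.sort fun i : Fin n => W i
  descents_eq : descents π = {countFalse W n}

theorem letter_succ {n : ℕ} (π : Equiv.Perm (Fin n)) (i : Fin n) :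
    letter π (i + 1) = (π i : ℕ) + 1 := by
  simp [letter, Nat.succ_le_of_lt i.is_lt]

theorem letter_lt_letter_succ {n : ℕ} {π : Equiv.Perm (Fin n)} {i : ℕ} (h1 : 1 ≤ i) (hn : i < n)
    (h : i ∉ descents π) : letter π i < letter π (i + 1) := by
  obtain ⟨i, rfl⟩ : ∃ k, i = k + 1 := ⟨i - 1, by omega⟩
  have e1 := letter_succ π ⟨i, by omega⟩
  have e2 := letter_succ π ⟨i + 1, by omega⟩
  have hne : (π ⟨i, by omega⟩ : ℕ) ≠ π ⟨i + 1, by omega⟩ := fun h => by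
    simpa using π.injective (Fin.ext h)
  simp only [descents, Finset.mem_filter, Finset.mem_Ico, not_and, not_lt] at h
  have := h ⟨h1, hn⟩
  simp only at e1 e2
  omega

theorem letter_strictMono {n : ℕ} {π : Equiv.Perm (Fin n)} {i j : ℕ} (h1 : 1 ≤ i) (hij : i < j)
    (hj : j ≤ n) (h : ∀ k, i ≤ k → k < j → k ∉ descents π) : letter π i < letter π j := by
  induction j, hij using Nat.le_induction with
  | base => exact letter_lt_letter_succ h1 (by omega) (h i le_rfl (by simp))
  | succ j hij ih =>
    exact (ih (by omega) fun k hk hkj => h k hk (by omega)).trans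
      (letter_lt_letter_succ (by omega) (by omega) (h j (by omega) (by simp)))

theorem exists_isValueWord {n : ℕ} {π : Equiv.Perm (Fin n)} (hπ : (descents π).card = 1) :
    ∃ W, IsValueWord π W := by
  obtain ⟨d, hd⟩ := Finset.card_eq_one.1 hπ
  -- Positions are zero-based here, so the second run starts at index `d`.
  obtain ⟨W, hW⟩ : ∃ W : ℕ → Bool, ∀ i : Fin n, W (π i) = decide (d ≤ i) :=
    ⟨fun k => if h : k < n then decide (d ≤ (π.symm ⟨k, h⟩ : ℕ)) else false, by simp⟩
  have hsort : π = Tuple.sort fun i : Fin n => W i := by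
    refine Tuple.eq_sort_iff.2 ⟨fun i j hij => ?_, fun i j hij he => ?_⟩
    · have : (i : ℕ) ≤ j := hij
      simp only [Function.comp, hW, Bool.le_iff_imp, decide_eq_true_eq]
      omega
    · have hij' : (i : ℕ) < j := hij
      simp only [hW, decide_eq_decide] at he
      have := letter_strictMono (π := π) (i := i + 1) (j := j + 1) (by omega) (by omega) (by omega)
        (by
          intro k hk hkj
          rw [hd, Finset.mem_singleton]
          omega)
      rw [letter_succ, letter_succ] at this
      exact Fin.lt_def.2 (by omega)
  refine ⟨W, hsort, ?_⟩
  have hd' : d ∈ descents π := by simp [hd]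
  simp only [descents, Finset.mem_filter, Finset.mem_Ico] at hd'
  have hpos : ∀ i : Fin n, (i : ℕ) = sortedPos W n (π i) := fun i => by
    rw [← sort_symm_apply, ← hsort, Equiv.symm_apply_apply]
  have h1 := hpos ⟨d - 1, by omega⟩
  have h2 := hpos ⟨d, by omega⟩
  have w1 := hW ⟨d - 1, by omega⟩
  have w2 := hW ⟨d, by omega⟩
  simp only [le_refl, decide_true] at w2
  have w1' : W (π ⟨d - 1, by omega⟩) = false := by
    rw [w1]
    simp
    omega
  simp only [sortedPos, w1', w2] at h1 h2
  have h3 := countFalse_succ W (π ⟨d - 1, by omega⟩)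
  have h4 := countFalse_mono W (Nat.succ_le_of_lt (π ⟨d - 1, by omega⟩).is_lt)
  simp [w1'] at h1 h2 h3
  rw [hd, Finset.singleton_inj]
  simp only [Nat.succ_eq_add_one] at h4
  omega

namespace IsValueWord

variable {n : ℕ} {π : Equiv.Perm (Fin n)} {W : ℕ → Bool}

theorem symm_apply (h : IsValueWord π W) (v : Fin n) : (π.symm v : ℕ) = sortedPos W n v := by
  rw [← sort_symm_apply, ← h.eq_sort]

theorem sortedPos_lt (h : IsValueWord π W) {v : ℕ} (hv : v < n) : sortedPos W n v < n := by
  rw [← h.symm_apply ⟨v, hv⟩]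
  exact Fin.is_lt _

theorem letter_sortedPos (h : IsValueWord π W) {v : ℕ} (hv : v < n) :
    letter π (sortedPos W n v + 1) = v + 1 := by
  rw [← h.symm_apply ⟨v, hv⟩, letter_succ, Equiv.apply_symm_apply]

theorem exists_sortedPos (h : IsValueWord π W) {i : ℕ} (hi : 1 ≤ i) (hn : i ≤ n) :
    ∃ v < n, sortedPos W n v + 1 = i ∧ letter π i = v + 1 := by
  have hp : sortedPos W n (π ⟨i - 1, by omega⟩) + 1 = i := by
    rw [← h.symm_apply, Equiv.symm_apply_apply]
    simp only
    omega
  refine ⟨π ⟨i - 1, by omega⟩, Fin.is_lt _, hp, ?_⟩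
  conv_lhs => rw [← hp]
  exact h.letter_sortedPos (Fin.is_lt _)

theorem descent (h : IsValueWord π W) : 0 < countFalse W n ∧ countFalse W n < n ∧
    letter π (countFalse W n + 1) < letter π (countFalse W n) := by
  have : countFalse W n ∈ descents π := by simp [h.descents_eq]
  simp only [descents, Finset.mem_filter, Finset.mem_Ico] at this
  exact ⟨by omega, this.1.2, this.2⟩

theorem sortedPos_of_false {v : ℕ} (hv : W v = false) : sortedPos W n v = countFalse W v := by
  simp [sortedPos, hv]

theorem sortedPos_of_true {v : ℕ} (hv : W v = true) :
    sortedPos W n v + countFalse W v = countFalse W n + v := by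
  have := countFalse_le W v
  simp [sortedPos, hv]
  omega

theorem sortedPos_lt_iff {v : ℕ} (hv : v < n) :
    sortedPos W n v < countFalse W n ↔ W v = false := by
  have h1 := countFalse_le W v
  cases hW : W v
  · have h2 := countFalse_succ W v
    have h3 := countFalse_mono W (Nat.succ_le_of_lt hv)
    simp only [hW, Nat.succ_eq_add_one] at h2 h3
    simp [sortedPos_of_false hW]
    simp at h2
    omega
  · have := sortedPos_of_true (n := n) hW
    simp
    omega

/-- Consecutive values in the same run are neighbours, as nothing lies between them in value. In
different runs they could be neighbours in this order only across the descent, where the letters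
decrease. -/
theorem mem_repeats_iff (h : IsValueWord π W) {r : ℕ} : r ∈ repeats W n ↔
    1 ≤ r ∧ r < n ∧ sortedPos W n r = sortedPos W n (r - 1) + 1 := by
  simp only [repeats, Finset.mem_filter, Finset.mem_Ico, and_assoc]
  refine and_congr_right fun h1 => and_congr_right fun h2 => ?_
  obtain ⟨r, rfl⟩ : ∃ k, r = k + 1 := ⟨r - 1, by omega⟩
  rw [Nat.add_sub_cancel]
  have hs := countFalse_succ W r
  have hl := countFalse_le W r
  constructor
  · intro he
    cases hW : W r
    · have hW' := he ▸ hW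
      simp [sortedPos_of_false hW, sortedPos_of_false hW', hs, hW]
    · have hW' := he ▸ hW
      have e1 := sortedPos_of_true (n := n) hW
      have e2 := sortedPos_of_true (n := n) hW'
      simp [hW] at hs
      omega
  · intro he
    by_contra hne
    cases hW : W r
    · have hW' : W (r + 1) = true := by simpa [hW] using Ne.symm hne
      have h3 := (sortedPos_lt_iff (W := W) (n := n) (v := r) (by omega)).2 hW
      have h4 := (not_congr (sortedPos_lt_iff (W := W) h2)).2 (by simp [hW'])
      have e : sortedPos W n r + 1 = countFalse W n := by omega
      have l1 := h.letter_sortedPos (v := r) (by omega)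
      have l2 := h.letter_sortedPos h2
      rw [he, e] at l2
      rw [e] at l1
      have := h.descent
      omega
    · have hW' : W (r + 1) = false := by simpa [hW] using Ne.symm hne
      have h4 := (sortedPos_lt_iff (W := W) h2).2 hW'
      have h3 := (not_congr (sortedPos_lt_iff (W := W) (n := n) (v := r) (by omega))).2
        (by simp [hW])
      omega

theorem _root_.mem_adjacencyPairs {n : ℕ} {π : Equiv.Perm (Fin n)} {i : ℕ} :
    i ∈ adjacencyPairs π ↔ 1 ≤ i ∧ i < n ∧ letter π (i + 1) = letter π i + 1 := by
  rw [adjacencyPairs, Finset.mem_filter, Finset.mem_Icc, IsAdjacency]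
  constructor
  · rintro ⟨-, h1, h2, h3⟩
    exact ⟨h1, by omega, h3 1 (by simp)⟩
  · rintro ⟨h1, h2, h3⟩
    refine ⟨by omega, h1, by omega, fun j hj => ?_⟩
    interval_cases j
    · rfl
    · exact h3

theorem mem_adjacencyPairs_iff (h : IsValueWord π W) {i : ℕ} : i ∈ adjacencyPairs π ↔
    letter π i ∈ repeats W n ∧ sortedPos W n (letter π i - 1) + 1 = i := by
  rw [mem_adjacencyPairs, h.mem_repeats_iff]
  constructor
  · rintro ⟨h1, h2, h3⟩
    obtain ⟨v, hv, hp, hl⟩ := h.exists_sortedPos h1 h2.le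
    obtain ⟨v', hv', hp', hl'⟩ := h.exists_sortedPos (i := i + 1) (by omega) h2
    have e : v' = v + 1 := by omega
    subst e
    simp only [hl, Nat.add_sub_cancel]
    omega
  · rintro ⟨⟨h1, h2, h3⟩, h4⟩
    have l1 := h.letter_sortedPos h2
    have := h.sortedPos_lt h2
    rw [h3, h4] at l1
    omega

theorem sortedPos_mem_adjacencyPairs (h : IsValueWord π W) {r : ℕ} (hr : r ∈ repeats W n) :
    sortedPos W n (r - 1) + 1 ∈ adjacencyPairs π ∧
      letter π (sortedPos W n (r - 1) + 1) = r := by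
  have hr' := h.mem_repeats_iff.1 hr
  have l := h.letter_sortedPos (v := r - 1) (by omega)
  have e : letter π (sortedPos W n (r - 1) + 1) = r := by omega
  refine ⟨h.mem_adjacencyPairs_iff.2 ?_, e⟩
  rw [e]
  exact ⟨hr, rfl⟩

/-- The index of a repeat is the zero-based value of the second letter of the pair, which is the
one-based value of the first. -/
theorem repeats_eq_image (h : IsValueWord π W) :
    repeats W n = (adjacencyPairs π).image (letter π) := by
  ext r
  rw [Finset.mem_image]
  constructor
  · intro hr
    exact ⟨_, h.sortedPos_mem_adjacencyPairs hr⟩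
  · rintro ⟨i, hi, rfl⟩
    exact (h.mem_adjacencyPairs_iff.1 hi).1

theorem card_repeats (h : IsValueWord π W) : (repeats W n).card = (adjacencyPairs π).card := by
  rw [h.repeats_eq_image, Finset.card_image_of_injOn]
  intro i hi j hj hij
  rw [← (h.mem_adjacencyPairs_iff.1 hi).2, ← (h.mem_adjacencyPairs_iff.1 hj).2, hij]

theorem permMu_eq (h : IsValueWord π W) :
    permMu π = (-1) ^ (n + 1) * (normalPairs W n).card := by
  have e : FinPerm.ofWord (word W n) = ⟨n, π⟩ := by
    rw [word, FinPerm.ofWord_ofFn, ← h.eq_sort]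
  -- Otherwise the word is monotone and its sort is the identity, which has no descent.
  have hp : [true, false].Sublist (word W n) := by
    by_contra hp
    rw [word, FinPerm.ofWord_ofFn, ← h.eq_sort] at e
    rw [FinPerm.pair_sublist_iff, not_not] at hp
    have hm : Monotone fun i : Fin n => W i := by
      intro i j hij
      have := hp (show (i.cast (by simp [word]) : Fin (word W n).length) ≤
        j.cast (by simp [word]) from hij)
      simp only [word, List.get_ofFn] at this
      exact this
    have h1 := h.eq_sort.trans (Tuple.sort_eq_refl_iff_monotone.2 hm)
    obtain ⟨h2, h3, h4⟩ := h.descent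
    have l1 := letter_succ π ⟨countFalse W n - 1, by omega⟩
    have l2 := letter_succ π ⟨countFalse W n, by omega⟩
    simp only [h1, Equiv.refl_apply] at l1 l2
    rw [← h1] at l1 l2
    rw [Nat.sub_add_cancel h2] at l1
    omega
  rw [permMu, ← e, FinPerm.mu_ofWord hp, normalCount_eq_card]
  simp [word]

end IsValueWord

/-! ### The cases of the theorem -/

namespace IsValueWord

variable {n : ℕ} {π : Equiv.Perm (Fin n)} {W : ℕ → Bool}

theorem abs_permMu (h : IsValueWord π W) : |permMu π| = (normalPairs W n).card := by
  rw [h.permMu_eq, abs_mul, abs_pow, abs_neg, abs_one, one_pow, one_mul, Nat.abs_cast]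

theorem permMu_eq_zero_iff (h : IsValueWord π W) : permMu π = 0 ↔ normalPairs W n = ∅ := by
  rw [← abs_eq_zero, h.abs_permMu, Nat.cast_eq_zero, Finset.card_eq_zero]

theorem pos_iff_odd (h : IsValueWord π W) (h0 : permMu π ≠ 0) : 0 < permMu π ↔ Odd n := by
  have hc : (0 : ℤ) < (normalPairs W n).card := by
    rw [← h.abs_permMu]
    exact abs_pos.2 h0
  rw [h.permMu_eq]
  rcases Nat.even_or_odd n with hn | hn
  · rw [hn.add_one.neg_one_pow]
    simp only [Nat.not_odd_iff_even.2 hn, iff_false]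
    linarith
  · rw [hn.add_one.neg_one_pow]
    simp only [hn, iff_true]
    linarith

theorem mem_normalPairs {a b : ℕ} : (a, b) ∈ normalPairs W n ↔
    a < b ∧ b < n ∧ W a = true ∧ W b = false ∧ ∀ r ∈ repeats W n, r = a ∨ r = b := by
  simp only [normalPairs, Finset.mem_filter, Finset.mem_product, Finset.mem_range,
    Finset.subset_iff, Finset.mem_insert, Finset.mem_singleton]
  constructor
  · rintro ⟨⟨h1, h2⟩, h3, h4, h5, h6⟩
    exact ⟨h3, h2, h4, h5, @h6⟩
  · rintro ⟨h3, h2, h4, h5, h6⟩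
    exact ⟨⟨h3.trans h2, h2⟩, h3, h4, h5, @h6⟩

theorem permMu_eq_zero (h : IsValueWord π W)
    (hW : ∀ a b, a < b → b < n → W a = true → W b = false →
      (∀ r ∈ repeats W n, r = a ∨ r = b) → False) : permMu π = 0 := by
  rw [h.permMu_eq_zero_iff, Finset.eq_empty_iff_forall_notMem]
  rintro ⟨a, b⟩ hab
  obtain ⟨h1, h2, h3, h4, h5⟩ := mem_normalPairs.1 hab
  exact hW a b h1 h2 h3 h4 h5

theorem eq_of_mem_repeats {r : ℕ} (hr : r ∈ repeats W n) : 1 ≤ r ∧ r < n ∧ W (r - 1) = W r := by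
  simpa [repeats, and_assoc] using hr

theorem letter_mem_repeats (h : IsValueWord π W) {i : ℕ} (h1 : 1 ≤ i) (hn : i < n)
    (hl : letter π (i + 1) = letter π i + 1) : letter π i ∈ repeats W n :=
  (h.mem_adjacencyPairs_iff.1 (mem_adjacencyPairs.2 ⟨h1, hn, hl⟩)).1

theorem word_letter_pred_eq_false_iff (h : IsValueWord π W) {i : ℕ} (hi : 1 ≤ i) (hn : i ≤ n) :
    W (letter π i - 1) = false ↔ i ≤ countFalse W n := by
  obtain ⟨v, hv, h1, h2⟩ := h.exists_sortedPos hi hn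
  rw [h2, Nat.add_sub_cancel, ← sortedPos_lt_iff hv]
  omega

theorem word_zero (h : IsValueWord π W) (hn : 0 < n) : W 0 = false ↔ letter π 1 = 1 := by
  have h1 := h.letter_sortedPos hn
  have h2 := h.descent.1
  constructor
  · intro hW
    rw [sortedPos_of_false hW] at h1
    simpa using h1
  · intro hl
    have := h.word_letter_pred_eq_false_iff le_rfl hn
    rw [hl] at this
    exact this.2 h2

theorem word_last (h : IsValueWord π W) (hn : 0 < n) : W (n - 1) = true ↔ letter π n = n := by
  have h1 := h.letter_sortedPos (v := n - 1) (by omega)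
  have h2 := h.descent.2.1
  constructor
  · intro hW
    have h3 := sortedPos_of_true (n := n) hW
    have h4 := countFalse_succ W (n - 1)
    rw [Nat.sub_add_cancel hn] at h4
    simp [hW] at h4
    rwa [show sortedPos W n (n - 1) + 1 = n by omega, Nat.sub_add_cancel hn] at h1
  · intro hl
    have := h.word_letter_pred_eq_false_iff hn le_rfl
    rw [hl] at this
    simpa using (not_congr this).2 (by omega)

/-- The word begins with 00. The repeat at index 1 carries `false`, so it must be the second index
of a normal pair, but no `true` precedes it. -/
theorem permMu_eq_zero_of_begins (h : IsValueWord π W) (hn : 2 < n) (h1 : letter π 1 = 1)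
    (h2 : letter π 2 = 2) : permMu π = 0 := by
  have hr := h.letter_mem_repeats (i := 1) le_rfl (by omega) (by rw [h1, h2])
  have hW := (h.word_zero (by omega)).2 h1
  rw [h1] at hr
  refine h.permMu_eq_zero fun a b hab hb hWa hWb hall => ?_
  have hW1 : W 1 = false := (eq_of_mem_repeats hr).2.2 ▸ hW
  rcases hall 1 hr with rfl | rfl
  · simp [hW1] at hWa
  · obtain rfl : a = 0 := by omega
    simp [hW] at hWa

theorem permMu_eq_zero_of_ends (h : IsValueWord π W) (hn : 2 < n)
    (h1 : letter π (n - 1) = n - 1) (h2 : letter π n = n) : permMu π = 0 := by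
  have e : n - 1 + 1 = n := by omega
  have hr := h.letter_mem_repeats (i := n - 1) (by omega) (by omega) (by rw [e, h1, h2, e])
  have hW := (h.word_last (by omega)).2 h2
  rw [h1] at hr
  refine h.permMu_eq_zero fun a b hab hb hWa hWb hall => ?_
  rcases hall _ hr with rfl | rfl
  · omega
  · simp [hW] at hWb

/-- Two repeats with the same letter would have to be the two indices of a normal pair, whose
letters differ. -/
theorem permMu_eq_zero_of_triple (h : IsValueWord π W) {i : ℕ} (hi : IsAdjacency π i 3) :
    permMu π = 0 := by
  obtain ⟨h1, h2, h3⟩ := hi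
  have l1 := h3 1 (by simp)
  have l2 := h3 2 (by simp)
  have r1 := h.letter_mem_repeats h1 (by omega) l1
  have r2 := h.letter_mem_repeats (i := i + 1) (by omega) (by omega) (by rw [l1, ← l2])
  rw [l1] at r2
  have hW := (eq_of_mem_repeats r2).2.2
  rw [Nat.add_sub_cancel] at hW
  refine h.permMu_eq_zero fun a b hab hb hWa hWb hall => ?_
  rcases hall _ r1 with e | e <;> rcases hall _ r2 with e' | e'
  · omega
  · rw [e', e, hWa, hWb] at hW
    simp at hW
  · rw [e', e, hWa, hWb] at hW
    simp at hW
  · omega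

theorem permMu_eq_zero_of_two_lt_card (h : IsValueWord π W) (hc : 2 < (adjacencyPairs π).card) :
    permMu π = 0 := by
  refine h.permMu_eq_zero fun a b hab hb hWa hWb hall => ?_
  rw [← h.card_repeats] at hc
  have : repeats W n ⊆ {a, b} := fun r hr => by simpa using hall r hr
  exact absurd ((Finset.card_le_card this).trans Finset.card_le_two) (by omega)

theorem sortedPos_lt_sortedPos {u v : ℕ} (huv : u < v) (h : W u = W v) :
    sortedPos W n u < sortedPos W n v := by
  have h1 := countFalse_sub_le W (Nat.succ_le_of_lt huv)
  have h2 := countFalse_mono W (Nat.succ_le_of_lt huv)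
  have h3 := countFalse_succ W u
  rw [Nat.succ_eq_add_one] at h1 h2
  cases hW : W v
  · rw [hW] at h
    rw [sortedPos_of_false h, sortedPos_of_false hW]
    simp [h] at h3
    omega
  · rw [hW] at h
    have h4 := sortedPos_of_true (n := n) h
    have h5 := sortedPos_of_true (n := n) hW
    simp [h] at h3
    omega

/-- The only candidate for a normal pair consists of the two repeats in increasing order. It reads
10 exactly when the pair of smaller value lies in the second run, hence at the later position. -/
theorem two_pairs (h : IsValueWord π W) {k j : ℕ} (hkj : k < j) (hadj : adjacencyPairs π = {k, j}) :
    (letter π j < letter π k → |permMu π| = 1) ∧ (letter π k < letter π j → permMu π = 0) := by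
  have hk : k ∈ adjacencyPairs π := by simp [hadj]
  have hj : j ∈ adjacencyPairs π := by simp [hadj]
  have hR : repeats W n = {letter π k, letter π j} := by
    rw [h.repeats_eq_image, hadj, Finset.image_insert, Finset.image_singleton]
  obtain ⟨rk, pk⟩ := h.mem_adjacencyPairs_iff.1 hk
  obtain ⟨rj, pj⟩ := h.mem_adjacencyPairs_iff.1 hj
  obtain ⟨k1, kn, ek⟩ := eq_of_mem_repeats rk
  obtain ⟨j1, jn, ej⟩ := eq_of_mem_repeats rj
  have hck := h.word_letter_pred_eq_false_iff (mem_adjacencyPairs.1 hk).1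
    (mem_adjacencyPairs.1 hk).2.1.le
  have hcj := h.word_letter_pred_eq_false_iff (mem_adjacencyPairs.1 hj).1
    (mem_adjacencyPairs.1 hj).2.1.le
  constructor
  · intro hlt
    have hne : W (letter π k) ≠ W (letter π j) := fun e => by
      have := sortedPos_lt_sortedPos (n := n) (W := W) (u := letter π j - 1)
        (v := letter π k - 1) (by omega) (by rw [ej, ek, e])
      omega
    have hWk : W (letter π k) = false := by
      by_contra hc
      have hWj : W (letter π j) = false := by
        cases hW : W (letter π j)
        · rfl
        · simp [hW] at hne hc
          exact absurd hc (by simpa using hne)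
      rw [ej] at hcj
      rw [ek] at hck
      exact hc (hck.2 (hkj.le.trans (hcj.1 hWj)))
    have hWj : W (letter π j) = true := by simpa [hWk] using hne.symm
    have : normalPairs W n = {(letter π j, letter π k)} := by
      ext ⟨a, b⟩
      rw [mem_normalPairs, hR, Finset.mem_singleton, Prod.mk.injEq]
      constructor
      · rintro ⟨hab, -, hWa, hWb, hall⟩
        have a1 := hall (letter π k) (by simp)
        have a2 := hall (letter π j) (by simp)
        omega
      · rintro ⟨rfl, rfl⟩
        exact ⟨hlt, kn, hWj, hWk, by simp⟩
    rw [h.abs_permMu, this]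
    simp
  · intro hlt
    refine h.permMu_eq_zero fun a b hab hb hWa hWb hall => ?_
    have a1 := hall _ rk
    have a2 := hall _ rj
    obtain rfl : a = letter π k := by omega
    obtain rfl : b = letter π j := by omega
    rw [ek, hWa] at hck
    rw [ej, hWb] at hcj
    have := hck.2 (hkj.le.trans (hcj.1 rfl))
    simp at this

/-- For `i < d` the repeat carries `false`, and the count is the number of `true` letters before it.
The word alternates up to there and `i` counts the `false` letters, so the two numbers agree or
differ by one according to the first letter. For `d < i` the same comparison is made after the
repeat, with the last letter deciding. -/
theorem one_pair (h : IsValueWord π W) {i d : ℕ} (hadj : adjacencyPairs π = {i})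
    (hd : descents π = {d}) :
    (i < d → letter π 1 ≠ 1 → |permMu π| = (i : ℤ)) ∧
    (i < d → letter π 1 = 1 → |permMu π| = (i : ℤ) - 1) ∧
    (d < i → letter π n ≠ n → |permMu π| = (n : ℤ) - (i : ℤ)) ∧
    (d < i → letter π n = n → |permMu π| = (n : ℤ) - (i : ℤ) - 1) := by
  have hi : i ∈ adjacencyPairs π := by simp [hadj]
  have hR : repeats W n = {letter π i} := by
    rw [h.repeats_eq_image, hadj, Finset.image_singleton]
  obtain ⟨hr, hp⟩ := h.mem_adjacencyPairs_iff.1 hi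
  obtain ⟨h1, hn, he⟩ := eq_of_mem_repeats hr
  have hc := h.word_letter_pred_eq_false_iff (mem_adjacencyPairs.1 hi).1
    (mem_adjacencyPairs.1 hi).2.1.le
  obtain rfl : d = countFalse W n := by
    rw [← Finset.singleton_inj, ← hd, h.descents_eq]
  obtain ⟨r, hlr⟩ : ∃ r, letter π i = r + 1 := ⟨letter π i - 1, by omega⟩
  rw [hlr] at hR hr hp h1 hn he hc
  rw [Nat.add_sub_cancel] at hp he hc
  have hs := countFalse_succ W r
  have hle := countFalse_le W r
  have hlow : i < countFalse W n → ((normalPairs W n).card + countFalse W (r + 1) = r + 1 ∧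
      countFalse W (r + 1) = i ∧ r % 2 = (if W 0 = false then 0 else 1) ∧
      countFalse W r = if W 0 = false then (r + 1) / 2 else r / 2) := by
    intro hid
    have hW := hc.2 hid.le
    have halt : ∀ k, k + 1 < r + 1 → W k ≠ W (k + 1) := by
      intro k hk hkk
      have : k + 1 ∈ repeats W n := by
        simp only [repeats, Finset.mem_filter, Finset.mem_Ico, Nat.add_sub_cancel]
        exact ⟨by omega, hkk⟩
      rw [hR, Finset.mem_singleton] at this
      omega
    obtain ⟨a1, a2⟩ := alternating_zero halt r
    have a3 := a1 (by omega)
    rw [card_normalPairs_of_repeats_eq_singleton_false hR (he ▸ hW)]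
    rw [sortedPos_of_false hW] at hp
    simp [hW] at hs
    refine ⟨by omega, by omega, ?_, a2 (by omega)⟩
    -- The letter just before the repeat is `false`, which fixes the parity of `r` in terms of the
    -- first letter.
    rw [hW] at a3
    rcases Nat.mod_two_eq_zero_or_one r with hm | hm <;> cases hW0 : W 0 <;>
      simp [hm, hW0] at a3 ⊢
  have hhigh : countFalse W n < i → ((normalPairs W n).card = countFalse W n - countFalse W r ∧
      i + countFalse W r = countFalse W n + r + 1 ∧
      (n - r) % 2 = (if W (n - 1) = true then 0 else 1) ∧
      countFalse W n = countFalse W r + (n - r - 1) / 2) := by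
    intro hid
    have hW : W r = true := by
      by_contra hW
      exact absurd (hc.1 (by simpa using hW)) (by omega)
    have hW' : W (r + 1) = true := he ▸ hW
    have halt : ∀ k, r + 1 + k + 1 < n → W (r + 1 + k) ≠ W (r + 1 + k + 1) := by
      intro k hk hkk
      have : r + 1 + k + 1 ∈ repeats W n := by
        simp only [repeats, Finset.mem_filter, Finset.mem_Ico, Nat.add_sub_cancel]
        exact ⟨by omega, hkk⟩
      rw [hR, Finset.mem_singleton] at this
      omega
    have a1 := (alternating halt (n - r - 2)).1 (by omega)
    have a2 := (alternating halt (n - r - 1)).2 (by omega)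
    rw [show r + 1 + (n - r - 2) = n - 1 by omega, hW'] at a1
    rw [show r + 1 + (n - r - 1) = n by omega, hW'] at a2
    simp [hW] at hs
    rw [card_normalPairs_of_repeats_eq_singleton_true hR hW', hs]
    have hp' := sortedPos_of_true (n := n) hW
    simp [hs] at a2
    refine ⟨by omega, by omega, ?_, by omega⟩
    rcases Nat.mod_two_eq_zero_or_one (n - r - 2) with hm | hm
    · simp [hm] at a1
      simp [a1]
      omega
    · simp [hm] at a1
      simp [a1]
      omega
  rw [h.abs_permMu]
  have w0 := h.word_zero (by omega)
  have wn := h.word_last (by omega)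
  refine ⟨fun hid hl => ?_, fun hid hl => ?_, fun hid hl => ?_, fun hid hl => ?_⟩
  · obtain ⟨b1, b2, b3, b4⟩ := hlow hid
    rw [if_neg (fun e => hl (w0.1 e))] at b3 b4
    simp [hc.2 hid.le] at hs
    omega
  · obtain ⟨b1, b2, b3, b4⟩ := hlow hid
    rw [if_pos (w0.2 hl)] at b3 b4
    simp [hc.2 hid.le] at hs
    omega
  · obtain ⟨b1, b2, b3, b4⟩ := hhigh hid
    rw [if_neg (fun e => hl (wn.1 e))] at b3
    omega
  · obtain ⟨b1, b2, b3, b4⟩ := hhigh hid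
    rw [if_pos (wn.2 hl)] at b3
    omega

theorem repeats_eq_empty (h : IsValueWord π W) (hadj : ¬ ∃ i l, 2 ≤ l ∧ IsAdjacency π i l) :
    repeats W n = ∅ := by
  rw [h.repeats_eq_image, Finset.image_eq_empty, Finset.eq_empty_iff_forall_notMem]
  intro i hi
  exact hadj ⟨i, 2, le_rfl, (Finset.mem_filter.1 hi).2⟩

theorem isW_or_isM (h : IsValueWord π W) (hR : repeats W n = ∅) :
    (W 0 = false → IsW π) ∧ (W 0 = true → IsM π) := by
  have halt : ∀ k, k + 1 < n → W k ≠ W (k + 1) := by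
    intro k hk he
    have : k + 1 ∈ repeats W n := by simp [repeats, hk, he]
    simp [hR] at this
  constructor
  · intro h0 i hi
    obtain ⟨h1, hn⟩ := Finset.mem_Icc.1 hi
    obtain ⟨v, hv, hp, hl⟩ := h.exists_sortedPos h1 hn
    obtain ⟨a1, a2⟩ := alternating_zero halt v
    have a1 := a1 hv
    have a2 := a2 hv.le
    have a3 := (alternating_zero halt n).2 le_rfl
    simp only [h0, if_true, Bool.not_false] at a1 a2 a3
    rw [hl]
    rcases Nat.mod_two_eq_zero_or_one v with hm | hm
    · rw [if_pos hm] at a1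
      rw [sortedPos_of_false a1] at hp
      split_ifs <;> omega
    · rw [if_neg (by omega)] at a1
      have := sortedPos_of_true (n := n) a1
      split_ifs <;> omega
  · intro h0 i hi
    obtain ⟨h1, hn⟩ := Finset.mem_Icc.1 hi
    obtain ⟨v, hv, hp, hl⟩ := h.exists_sortedPos h1 hn
    obtain ⟨a1, a2⟩ := alternating_zero halt v
    have a1 := a1 hv
    have a2 := a2 hv.le
    have a3 := (alternating_zero halt n).2 le_rfl
    simp only [h0, Bool.true_eq_false, if_false, Bool.not_true] at a1 a2 a3
    rw [hl]
    rcases Nat.mod_two_eq_zero_or_one v with hm | hm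
    · rw [if_pos hm] at a1
      have := sortedPos_of_true (n := n) a1
      split_ifs <;> omega
    · rw [if_neg (by omega)] at a1
      rw [sortedPos_of_false a1] at hp
      split_ifs <;> omega

theorem no_adjacencies (h : IsValueWord π W) (hn : 0 < n)
    (hadj : ¬ ∃ i l, 2 ≤ l ∧ IsAdjacency π i l) :
    (IsW π ∨ IsM π) ∧
    (Even n → letter π 1 = 1 → IsW π ∧ permMu π = -((n / 2).choose 2 : ℤ)) ∧
    (Even n → letter π 1 = 2 → IsM π ∧ permMu π = -((n / 2 + 1).choose 2 : ℤ)) ∧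
    (Odd n → permMu π = (((n + 1) / 2).choose 2 : ℤ)) := by
  have hR := h.repeats_eq_empty hadj
  obtain ⟨hw, hm⟩ := h.isW_or_isM hR
  have w0 := h.word_zero hn
  have hmu := h.permMu_eq
  rw [card_normalPairs_of_repeats_eq_empty hR] at hmu
  refine ⟨?_, fun he hl => ?_, fun he hl => ?_, fun ho => ?_⟩
  · cases h0 : W 0
    · exact Or.inl (hw h0)
    · exact Or.inr (hm h0)
  · have h0 := w0.2 hl
    have e : (n + 1) / 2 = n / 2 := by
      obtain ⟨m, rfl⟩ := he
      omega
    rw [he.add_one.neg_one_pow, if_pos h0, e] at hmu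
    exact ⟨hw h0, by simpa using hmu⟩
  · have h0 : ¬ W 0 = false := fun e => by
      have := w0.1 e
      omega
    rw [he.add_one.neg_one_pow, if_neg h0] at hmu
    exact ⟨hm (by simpa using h0), by simpa using hmu⟩
  -- For odd `n` the closed forms for the two possible first letters coincide.
  · have e : n / 2 + 1 = (n + 1) / 2 := by
      obtain ⟨m, rfl⟩ := ho
      omega
    rw [ho.add_one.neg_one_pow, e, ite_self] at hmu
    simpa using hmu

end IsValueWord

theorem theorem3p6 (n : ℕ) (hn : 2 < n) (π : Equiv.Perm (Fin n))
    (hπ : (descents π).card = 1) :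
    -- the sign
    (permMu π ≠ 0 → (0 < permMu π ↔ Odd n)) ∧
    -- `π` begins with `12` or ends in `(n-1)n`
    ((letter π 1 = 1 ∧ letter π 2 = 2) ∨ (letter π (n - 1) = n - 1 ∧ letter π n = n) →
      permMu π = 0) ∧
    -- a triple adjacency
    ((∃ i, IsAdjacency π i 3) → permMu π = 0) ∧
    -- more than two adjacency pairs
    (2 < (adjacencyPairs π).card → permMu π = 0) ∧
    -- exactly two adjacency pairs
    (∀ k j : ℕ, k < j → adjacencyPairs π = {k, j} →
      (letter π j < letter π k → |permMu π| = 1) ∧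
      (letter π k < letter π j → permMu π = 0)) ∧
    -- exactly one adjacency pair, at position `i`, and the descent at position `d`
    (∀ i d : ℕ, adjacencyPairs π = {i} → descents π = {d} →
      (i < d → letter π 1 ≠ 1 → |permMu π| = (i : ℤ)) ∧
      (i < d → letter π 1 = 1 → |permMu π| = (i : ℤ) - 1) ∧
      (d < i → letter π n ≠ n → |permMu π| = (n : ℤ) - (i : ℤ)) ∧
      (d < i → letter π n = n → |permMu π| = (n : ℤ) - (i : ℤ) - 1)) ∧
    -- no adjacencies
    ((¬ ∃ i l, 2 ≤ l ∧ IsAdjacency π i l) →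
      (IsW π ∨ IsM π) ∧
      (Even n → letter π 1 = 1 → IsW π ∧ permMu π = -((n / 2).choose 2 : ℤ)) ∧
      (Even n → letter π 1 = 2 → IsM π ∧ permMu π = -((n / 2 + 1).choose 2 : ℤ)) ∧
      (Odd n → permMu π = (((n + 1) / 2).choose 2 : ℤ))) := by
  obtain ⟨W, h⟩ := exists_isValueWord hπ
  refine ⟨h.pos_iff_odd, ?_, ?_, h.permMu_eq_zero_of_two_lt_card, fun k j => h.two_pairs,
    fun i d => h.one_pair, h.no_adjacencies (by omega)⟩
  · rintro (⟨h1, h2⟩ | ⟨h1, h2⟩)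
    · exact h.permMu_eq_zero_of_begins hn h1 h2
    · exact h.permMu_eq_zero_of_ends hn h1 h2
  · rintro ⟨i, hi⟩
    exact h.permMu_eq_zero_of_triple hi
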